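/- Let $d\ge 2$. For $\vec x\in\mathbb{Z}^m$ write $\|\vec x\|_1=|x_1|+\dots+|x_m|$, and for $m\ge1$ and real $r\ge 0$ let $N_{1,m}(r)=\#\{\vec x\in\mathbb{Z}^m:\|\vec x\|_1\le r\}$. For $f:\mathbb{Z}^d\to\mathbb{R}$ define the centered discrete maximal function over $\ell^1$-balls and the total variation by $$M_1f(\vec n)=\sup_{r\ge 0}\frac1{N_{1,d}(r)}\sum_{\vec m\in\mathbb{Z}^d,\ \|\vec m\|_1\le r}|f(\vec n+\vec m)|,\qquad \operatorname{Var} g=\sum_{i=1}^d\sum_{\vec n\in\mathbb{Z}^d}|g(\vec n+\vec e_i)-g(\vec n)|,$$ where the supremum is over real radii and $\vec e_i$ is the $i$-th canonical basis vector. Put $$C(d)=2d\left(1+\sum_{k\ge1}\frac{N_{1,d-1}(k)-N_{1,d-1}(k-1)}{N_{1,d}(k)}\right).$$ Then the series converges, so that $C(d)<\infty$, and for every $f\in\ell^1(\mathbb{Z}^d)$ $$\operatorname{Var}M_1f\le C(d)\,\|f\|_{\ell^1(\mathbb{Z}^d)}.$$ The constant is best possible: if $C\in\mathbb{R}$ and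 $\operatorname{Var}M_1f\le C\|f\|_{\ell^1(\mathbb{Z}^d)}$ for all $f\in\ell^1(\mathbb{Z}^d)$, then $C\ge C(d)$. Moreover, for $f\in\ell^1(\mathbb{Z}^d)$, equality $\operatorname{Var}M_1f=C(d)\|f\|_{\ell^1(\mathbb{Z}^d)}$ holds if and only if $f$ is a delta function, i.e. there is $\vec p\in\mathbb{Z}^d$ with $f(\vec n)=0$ for all $\vec n\ne\vec p$ (the value $f(\vec p)\in\mathbb{R}$ is arbitrary and may be $0$). -/

import Mathlib

open scoped ENNReal NNReal

noncomputable section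

namespace DiscreteMaximal

/-- The `ℓ¹`-norm `|x₁| + ⋯ + |x_d|` of a lattice point. -/
def latticeNorm {d : ℕ} (x : Fin d → ℤ) : ℤ := ∑ i, |x i|

theorem finite_latticeNorm_le (d : ℕ) (r : ℝ) :
    {x : Fin d → ℤ | (latticeNorm x : ℝ) ≤ r}.Finite := by
  refine (Set.finite_Icc (fun _ : Fin d => -⌊r⌋) (fun _ => ⌊r⌋)).subset fun x hx => ?_
  have h : ∀ i, |x i| ≤ ⌊r⌋ := fun i =>
    (Finset.single_le_sum (f := fun i => |x i|) (fun j _ => abs_nonneg (x j))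
      (Finset.mem_univ i)).trans (Int.le_floor.2 hx)
  exact ⟨fun i => (abs_le.1 (h i)).1, fun i => (abs_le.1 (h i)).2⟩

/-- The lattice points of the closed `ℓ¹`-ball (rhombus) of radius `r` centred at the origin. -/
def rhombus (d : ℕ) (r : ℝ) : Finset (Fin d → ℤ) := (finite_latticeNorm_le d r).toFinset

/-- The number of points of `ℤ^d` with `ℓ¹`-norm at most `r`. -/
def latticeCount (d : ℕ) (r : ℝ) : ℕ := (rhombus d r).card

/-- The average of `|f|` over the lattice points of the `ℓ¹`-ball of centre `n` and radius `r`. -/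
def average {d : ℕ} (f : (Fin d → ℤ) → ℝ) (r : ℝ) (n : Fin d → ℤ) : ℝ :=
  (1 / (latticeCount d r : ℝ)) * ∑ m ∈ rhombus d r, |f (n + m)|

/-- The discrete centred maximal function over `ℓ¹`-balls of all real radii `r ≥ 0`. For
`f ∈ ℓ¹` the averages are bounded by the norm of `f`, so this is a genuine supremum. -/
def maximalFunction {d : ℕ} (f : (Fin d → ℤ) → ℝ) (n : Fin d → ℤ) : ℝ :=
  ⨆ r : ℝ≥0, average f r n

/-- The total variation `∑ᵢ ∑ₙ |g (n + eᵢ) - g n|`, a value in `[0, ∞]`. -/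
def variation {d : ℕ} (g : (Fin d → ℤ) → ℝ) : ℝ≥0∞ :=
  ∑ i : Fin d, ∑' n : Fin d → ℤ, ENNReal.ofReal |g (n + Pi.single i 1) - g n|

/-- `f` vanishes outside one point (its value there is an arbitrary real number). -/
def IsDelta {d : ℕ} (f : (Fin d → ℤ) → ℝ) : Prop :=
  ∃ (p : Fin d → ℤ) (k : ℝ), f p = k ∧ ∀ n, n ≠ p → f n = 0

/-- The summand with index `k + 1` of the series in the sharp constant, `k = 0, 1, 2, …`. -/
def constantTerm (d k : ℕ) : ℝ :=
  ((latticeCount (d - 1) ((k + 1 : ℕ) : ℝ) : ℝ) - (latticeCount (d - 1) (k : ℝ) : ℝ)) /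
    (latticeCount d ((k + 1 : ℕ) : ℝ) : ℝ)

/-- The sharp constant `C(d)`. -/
def sharpConstant (d : ℕ) : ℝ := 2 * (d : ℝ) * (1 + ∑' k : ℕ, constantTerm d k)

end DiscreteMaximal

end

open DiscreteMaximal

/-! Write `N(k)` for the number of lattice points in the `ℓ¹`-ball of radius `k`. The sequence `N`
is log-concave, so the decrements `1 / N(k) - 1 / N(k + 1)` decrease strictly. Comparing the average
over the ball of radius `k` about one end of a lattice edge with the average over the ball of
radius `k + 1` about the other end then bounds the increment `|M f(n + eᵢ) - M f(n)|` by the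
convolution of `|f|` with `|u(· + eᵢ) - u|`, where `u(x) = 1 / N(‖x‖₁)` is the maximal function of
the unit mass at the origin. Summation over all edges gives `Var M f ≤ ‖f‖₁ Var u`, and
`Var u = C(d)` by telescoping along the lines parallel to the axes. Equality for a point mass is
immediate. If `f` charges two points, then for some edge the end nearer to one of them is the end
farther from the other, and the strict decrease of the decrements makes the bound strict there.
-/

noncomputable section

namespace DiscreteMaximal

/-! ### Log-concave sequences -/

section LogConcave

variable {K : Type*} [Field K] [LinearOrder K] [IsStrictOrderedRing K] {a : ℕ → K}

/-- Log-concavity of a sequence, in the division-free form used for combinatorial counts. -/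
def LogConcave (a : ℕ → K) : Prop := ∀ k, a k * a (k + 2) ≤ a (k + 1) ^ 2

/-- The sequence whose generating function is `1 + x` times that of `a`. -/
def addShift (a : ℕ → K) : ℕ → K
  | 0 => a 0
  | k + 1 => a (k + 1) + a k

theorem LogConcave.mul_succ_le_succ_mul (h : LogConcave a) (hpos : ∀ k, 0 < a k) {j k : ℕ}
    (hjk : j ≤ k) : a j * a (k + 1) ≤ a (j + 1) * a k := by
  have hratio : Antitone fun k => a (k + 1) / a k := antitone_nat_of_succ_le fun k => by
    rw [div_le_div_iff₀ (hpos _) (hpos _), ← sq, mul_comm]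
    exact h k
  have := hratio hjk
  rwa [div_le_div_iff₀ (hpos _) (hpos _), mul_comm] at this

theorem LogConcave.addShift (h : LogConcave a) (hpos : ∀ k, 0 < a k) :
    LogConcave (addShift a)
  | 0 => by
    simp only [DiscreteMaximal.addShift]
    nlinarith [h 0, mul_pos (hpos 0) (hpos 0), mul_pos (hpos 0) (hpos 1)]
  | k + 1 => by
    have hfar : a k * a (k + 3) ≤ a (k + 1) * a (k + 2) :=
      h.mul_succ_le_succ_mul hpos (k.le_add_right 2)
    have h₀ : a k * a (k + 2) ≤ a (k + 1) ^ 2 := h k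
    have h₁ : a (k + 1) * a (k + 3) ≤ a (k + 2) ^ 2 := h (k + 1)
    calc (a (k + 1) + a k) * (a (k + 3) + a (k + 2))
        = a (k + 1) * a (k + 3) + a (k + 1) * a (k + 2) + a k * a (k + 3) + a k * a (k + 2) := by
          ring
      _ ≤ a (k + 2) ^ 2 + a (k + 1) * a (k + 2) + a (k + 1) * a (k + 2) + a (k + 1) ^ 2 := by
          gcongr
      _ = (a (k + 2) + a (k + 1)) ^ 2 := by ring

theorem LogConcave.sum_range_succ (h : LogConcave a) (hpos : ∀ k, 0 < a k) :
    LogConcave fun k => ∑ j ∈ Finset.range (k + 1), a j := fun k => by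
  simp only
  set s := ∑ j ∈ Finset.range (k + 1), a j
  have hsucc : ∑ j ∈ Finset.range (k + 1 + 1), a j = s + a (k + 1) := Finset.sum_range_succ _ _
  have hcross : s * a (k + 2) ≤ (s + a (k + 1)) * a (k + 1) :=
    calc s * a (k + 2) = ∑ j ∈ Finset.range (k + 1), a j * a (k + 2) := Finset.sum_mul _ _ _
      _ ≤ ∑ j ∈ Finset.range (k + 1), a (j + 1) * a (k + 1) := Finset.sum_le_sum fun j hj =>
          h.mul_succ_le_succ_mul hpos (Finset.mem_range.1 hj).le
      _ = (∑ j ∈ Finset.range (k + 1), a (j + 1)) * a (k + 1) := (Finset.sum_mul _ _ _).symm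
      _ ≤ (s + a (k + 1)) * a (k + 1) := by
          gcongr
          · exact (hpos _).le
          · rw [← hsucc, Finset.sum_range_succ' _ (k + 1)]
            exact le_add_of_nonneg_right (hpos 0).le
  rw [Finset.sum_range_succ _ (k + 2), hsucc]
  linear_combination hcross

theorem LogConcave.strictAnti_one_div_sub (h : LogConcave a) (hpos : ∀ k, 0 < a k)
    (hmono : StrictMono a) : StrictAnti fun k => 1 / a k - 1 / a (k + 1) := by
  have hfactor : ∀ k, 1 / a k - 1 / a (k + 1) = 1 / a k * (1 - a k / a (k + 1)) := fun k => by
    have := (hpos k).ne'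
    field_simp
  refine strictAnti_nat_of_succ_lt fun k => ?_
  have hlt : 1 / a (k + 1) < 1 / a k := one_div_lt_one_div_of_lt (hpos k) (hmono k.lt_succ_self)
  have hratio : a k / a (k + 1) ≤ a (k + 1) / a (k + 2) := by
    rw [div_le_div_iff₀ (hpos _) (hpos _), ← sq]
    exact h k
  have hratio_lt : a k / a (k + 1) < 1 := (div_lt_one (hpos _)).2 (hmono k.lt_succ_self)
  rw [hfactor, hfactor]
  calc 1 / a (k + 1) * (1 - a (k + 1) / a (k + 2))
      ≤ 1 / a (k + 1) * (1 - a k / a (k + 1)) :=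
        mul_le_mul_of_nonneg_left (sub_le_sub_left hratio 1) (one_div_pos.2 (hpos _)).le
    _ < 1 / a k * (1 - a k / a (k + 1)) := mul_lt_mul_of_pos_right hlt (sub_pos.2 hratio_lt)

end LogConcave

/-! ### Counting lattice points -/

/-- The `ℓ¹`-norm of a lattice point as a natural number, so that it can index shells and radii. -/
def natNorm {d : ℕ} (x : Fin d → ℤ) : ℕ := ∑ i, (x i).natAbs

/-- The number of points of `ℤ^d` with `ℓ¹`-norm at most the natural number `k`. -/
def ballCount (d k : ℕ) : ℕ := latticeCount d (k : ℝ)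

/-- The lattice points of `ℓ¹`-norm exactly `k`. -/
def shell (d k : ℕ) : Finset (Fin d → ℤ) := {x ∈ rhombus d (k : ℝ) | natNorm x = k}

section natNorm

variable {d : ℕ}

theorem natNorm_neg (x : Fin d → ℤ) : natNorm (-x) = natNorm x := by simp [natNorm]

theorem natNorm_eq_zero {x : Fin d → ℤ} : natNorm x = 0 ↔ x = 0 := by simp [natNorm, funext_iff]

theorem natNorm_insertNth (i : Fin (d + 1)) (a : ℤ) (y : Fin d → ℤ) :
    natNorm (Fin.insertNth i a y : Fin (d + 1) → ℤ) = a.natAbs + natNorm y := by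
  simp [natNorm, Fin.sum_univ_succAbove _ i]

theorem natNorm_cons (a : ℤ) (y : Fin d → ℤ) :
    natNorm (Fin.cons a y : Fin (d + 1) → ℤ) = a.natAbs + natNorm y := by
  rw [← Fin.insertNth_zero', natNorm_insertNth]

theorem natNorm_add_single (i : Fin d) (x : Fin d → ℤ) :
    natNorm (x + Pi.single i 1) + (x i).natAbs = natNorm x + (x i + 1).natAbs := by
  have hne : ∀ j ∈ Finset.univ.erase i,
      ((x + Pi.single i 1 : Fin d → ℤ) j).natAbs = (x j).natAbs := fun j hj => by
    simp [Pi.single_eq_of_ne (Finset.ne_of_mem_erase hj)]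
  rw [natNorm, natNorm, ← Finset.add_sum_erase _ _ (Finset.mem_univ i),
    ← Finset.add_sum_erase (f := fun j => (x j).natAbs) _ (Finset.mem_univ i),
    Finset.sum_congr rfl hne, Pi.add_apply, Pi.single_eq_same]
  ring

theorem natNorm_add_single_of_nonneg {i : Fin d} {x : Fin d → ℤ} (hx : 0 ≤ x i) :
    natNorm (x + Pi.single i 1) = natNorm x + 1 := by
  have := natNorm_add_single i x
  omega

theorem natNorm_eq_add_single_add_one {i : Fin d} {x : Fin d → ℤ} (hx : x i < 0) :
    natNorm x = natNorm (x + Pi.single i 1) + 1 := by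
  have := natNorm_add_single i x
  omega

end natNorm

theorem mem_rhombus {d : ℕ} {r : ℝ} {x : Fin d → ℤ} : x ∈ rhombus d r ↔ (natNorm x : ℝ) ≤ r := by
  simp [rhombus, latticeNorm, natNorm]

theorem mem_rhombus_natCast {d k : ℕ} {x : Fin d → ℤ} :
    x ∈ rhombus d (k : ℝ) ↔ natNorm x ≤ k := by
  simp [mem_rhombus]

theorem rhombus_floor (d : ℕ) (r : ℝ≥0) : rhombus d (⌊r⌋₊ : ℝ) = rhombus d r := by
  ext x
  rw [mem_rhombus_natCast, mem_rhombus, Nat.le_floor_iff zero_le, ← NNReal.coe_le_coe,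
    NNReal.coe_natCast]

theorem mem_shell {d k : ℕ} {x : Fin d → ℤ} : x ∈ shell d k ↔ natNorm x = k := by
  simp +contextual [shell, mem_rhombus_natCast]

theorem ballCount_pos (d k : ℕ) : 0 < ballCount d k :=
  Finset.card_pos.2 ⟨0, by simp [mem_rhombus_natCast, natNorm]⟩

theorem ballCount_dim_zero (k : ℕ) : ballCount 0 k = 1 :=
  Finset.card_eq_one.2
    ⟨0, by ext x; simp [mem_rhombus_natCast, natNorm, Subsingleton.elim x 0]⟩

theorem shell_zero (d : ℕ) : shell d 0 = {0} := by
  ext x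
  rw [mem_shell, natNorm_eq_zero, Finset.mem_singleton]

theorem ballCount_radius_zero (d : ℕ) : ballCount d 0 = 1 :=
  Finset.card_eq_one.2 ⟨0, by
    ext x; rw [mem_rhombus_natCast, Nat.le_zero, natNorm_eq_zero, Finset.mem_singleton]⟩

theorem ballCount_succ (d k : ℕ) :
    ballCount d (k + 1) = ballCount d k + (shell d (k + 1)).card := by
  have hdisj : Disjoint (rhombus d (k : ℝ)) (shell d (k + 1)) :=
    Finset.disjoint_left.2 fun x hx hx' => by
      rw [mem_rhombus_natCast] at hx
      rw [mem_shell] at hx'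
      omega
  rw [ballCount, ballCount, latticeCount, latticeCount, ← Finset.card_union_of_disjoint hdisj]
  congr 1
  ext x
  rw [Finset.mem_union, mem_rhombus_natCast, mem_rhombus_natCast, mem_shell]
  omega

-- A point of the shell is determined by its tail and by the sign of its first coordinate.
theorem card_shell_succ_succ (d k : ℕ) :
    (shell (d + 1) (k + 1)).card = ballCount d (k + 1) + ballCount d k := by
  have hinj : ∀ c : (Fin d → ℤ) → ℤ,
      Function.Injective fun y => (Fin.cons (c y) y : Fin (d + 1) → ℤ) :=
    fun c y z h => (Fin.cons_inj.1 h).2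
  have hmem : ∀ (j : ℕ) (c : (Fin d → ℤ) → ℤ) (a : ℤ) (y : Fin d → ℤ),
      Fin.cons a y ∈ (rhombus d (j : ℝ)).image (fun y => (Fin.cons (c y) y : Fin (d + 1) → ℤ)) ↔
        natNorm y ≤ j ∧ c y = a := by
    simp [mem_rhombus_natCast, Fin.cons_inj]
  set upper := (rhombus d ((k + 1 : ℕ) : ℝ)).image
    fun y => (Fin.cons ((k : ℤ) + 1 - natNorm y) y : Fin (d + 1) → ℤ)
  set lower := (rhombus d (k : ℝ)).image
    fun y => (Fin.cons (natNorm y - ((k : ℤ) + 1)) y : Fin (d + 1) → ℤ)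
  have hdisj : Disjoint upper lower :=
    Finset.disjoint_left.2 <| Fin.forall_fin_succ_pi.2 fun a y => by
      rw [hmem, hmem]
      omega
  have hunion : shell (d + 1) (k + 1) = upper ∪ lower :=
    Finset.ext <| Fin.forall_fin_succ_pi.2 fun a y => by
      rw [Finset.mem_union, hmem, hmem, mem_shell, natNorm_cons]
      omega
  rw [hunion, Finset.card_union_of_disjoint hdisj, Finset.card_image_of_injective _ (hinj _),
    Finset.card_image_of_injective _ (hinj _)]
  rfl

theorem ballCount_succ_succ (d k : ℕ) :
    ballCount (d + 1) (k + 1) = ballCount (d + 1) k + (ballCount d (k + 1) + ballCount d k) := by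
  rw [ballCount_succ, card_shell_succ_succ]

theorem ballCount_mono (d : ℕ) : Monotone (ballCount d) :=
  monotone_nat_of_le_succ fun k => (ballCount_succ d k).symm ▸ Nat.le_add_right _ _

theorem ballCount_strictMono (d : ℕ) : StrictMono (ballCount (d + 1)) :=
  strictMono_nat_of_lt_succ fun k => by
    rw [ballCount_succ_succ]
    exact Nat.lt_add_of_pos_right (Nat.add_pos_right _ (ballCount_pos d k))

-- Summing over the last coordinate multiplies the generating function of the ball counts by
-- `(1 + x) / (1 - x)`, and both factors preserve log-concavity.
theorem logConcave_ballCount (d : ℕ) : LogConcave fun k => (ballCount d k : ℝ) := by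
  induction d with
  | zero => simp [LogConcave, ballCount_dim_zero]
  | succ d ih =>
    have hpos : ∀ k, (0 : ℝ) < ballCount d k := fun k => Nat.cast_pos.2 (ballCount_pos d k)
    have hsum : (fun k => (ballCount (d + 1) k : ℝ)) = fun k =>
        ∑ j ∈ Finset.range (k + 1), addShift (fun k => (ballCount d k : ℝ)) j := by
      funext k
      induction k with
      | zero => simp [addShift, ballCount_radius_zero]
      | succ k ihk => rw [Finset.sum_range_succ, ← ihk, ballCount_succ_succ]; simp [addShift]
    rw [hsum]
    exact (ih.addShift hpos).sum_range_succ fun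
      | 0 => hpos 0
      | k + 1 => add_pos (hpos _) (hpos _)

theorem ballCount_le_pow (d k : ℕ) : ballCount d k ≤ (2 * k + 1) ^ d := by
  have hsub : rhombus d (k : ℝ) ⊆ Fintype.piFinset fun _ => Finset.Icc (-(k : ℤ)) k :=
    fun x hx => Fintype.mem_piFinset.2 fun i => by
      have hi : (x i).natAbs ≤ natNorm x :=
        Finset.single_le_sum (f := fun i => (x i).natAbs) (fun _ _ => Nat.zero_le _)
          (Finset.mem_univ i)
      rw [mem_rhombus_natCast] at hx
      rw [Finset.mem_Icc]
      omega
  refine (Finset.card_le_card hsub).trans_eq ?_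
  rw [Fintype.card_piFinset_const, Int.card_Icc]
  congr 1
  omega

theorem choose_le_ballCount (d k : ℕ) : (k + d).choose d ≤ ballCount d k := by
  induction d generalizing k with
  | zero => simp [ballCount_dim_zero]
  | succ d ihd =>
    induction k with
    | zero => simp [ballCount_radius_zero]
    | succ k ihk =>
      have hpascal : (k + 1 + (d + 1)).choose (d + 1) =
          (k + 1 + d).choose d + (k + (d + 1)).choose (d + 1) := by
        rw [← add_assoc (k + 1) d 1, Nat.choose_succ_succ, add_right_comm k 1 d, add_assoc k d 1]
      have := ihd (k + 1)
      rw [hpascal, ballCount_succ_succ]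
      omega

theorem pow_le_factorial_mul_ballCount (d k : ℕ) :
    ((k : ℝ) + 1) ^ d ≤ d.factorial * ballCount d k := by
  have hpow := Nat.pow_le_choose (α := ℝ) d (k + d)
  rw [add_right_comm, Nat.add_sub_cancel, div_le_iff₀' (by positivity)] at hpow
  push_cast at hpow
  refine hpow.trans ?_
  gcongr
  exact choose_le_ballCount d k

/-! ### Reciprocal ball counts and the sharp constant -/

/-- The decrement `1 / N(k) - 1 / N(k + 1)` of the reciprocal ball counts. -/
def gap (d k : ℕ) : ℝ := 1 / (ballCount d k : ℝ) - 1 / (ballCount d (k + 1) : ℝ)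

theorem one_div_ballCount_anti (d : ℕ) : Antitone fun k => 1 / (ballCount d k : ℝ) :=
  fun j _ hjk => one_div_le_one_div_of_le (Nat.cast_pos.2 (ballCount_pos d j))
    (Nat.cast_le.2 (ballCount_mono d hjk))

theorem one_div_ballCount_le_one (d k : ℕ) : 1 / (ballCount d k : ℝ) ≤ 1 :=
  div_le_one_of_le₀ (Nat.one_le_cast.2 (ballCount_pos d k)) (Nat.cast_nonneg _)

theorem gap_nonneg (d k : ℕ) : 0 ≤ gap d k :=
  sub_nonneg.2 (one_div_ballCount_anti d k.le_succ)

theorem gap_le_one (d k : ℕ) : gap d k ≤ 1 :=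
  (sub_le_self _ (by positivity)).trans (one_div_ballCount_le_one d k)

theorem gap_strictAnti (d : ℕ) : StrictAnti (gap (d + 1)) :=
  (logConcave_ballCount (d + 1)).strictAnti_one_div_sub
    (fun k => Nat.cast_pos.2 (ballCount_pos (d + 1) k))
    (Nat.strictMono_cast.comp (ballCount_strictMono d))

theorem tendsto_one_div_ballCount (d : ℕ) :
    Filter.Tendsto (fun k => 1 / (ballCount (d + 1) k : ℝ)) Filter.atTop (nhds 0) := by
  simp only [one_div]
  exact tendsto_inv_atTop_zero.comp
    (tendsto_natCast_atTop_atTop.comp (ballCount_strictMono d).tendsto_atTop)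

theorem hasSum_gap (d m : ℕ) :
    HasSum (fun j => gap (d + 1) (m + j)) (1 / (ballCount (d + 1) m : ℝ)) := by
  rw [hasSum_iff_tendsto_nat_of_nonneg fun j => gap_nonneg _ _]
  have htelescope : ∀ n, ∑ j ∈ Finset.range n, gap (d + 1) (m + j) =
      1 / (ballCount (d + 1) m : ℝ) - 1 / (ballCount (d + 1) (n + m) : ℝ) := fun n => by
    simpa [gap, add_assoc, add_comm n] using
      Finset.sum_range_sub' (fun j => 1 / (ballCount (d + 1) (m + j) : ℝ)) n
  simpa only [htelescope, sub_zero] using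
    ((Filter.tendsto_add_atTop_iff_nat m).2 (tendsto_one_div_ballCount d)).const_sub _

theorem tsum_ofReal_gap (d m : ℕ) :
    ∑' j, ENNReal.ofReal (gap (d + 1) (m + j)) =
      ENNReal.ofReal (1 / (ballCount (d + 1) m : ℝ)) := by
  rw [← ENNReal.ofReal_tsum_of_nonneg (fun j => gap_nonneg _ _) (hasSum_gap d m).summable,
    (hasSum_gap d m).tsum_eq]

theorem constantTerm_eq (d k : ℕ) :
    constantTerm (d + 1) k = (shell d (k + 1)).card / (ballCount (d + 1) (k + 1) : ℝ) := by
  have hcard : ((shell d (k + 1)).card : ℝ) = ballCount d (k + 1) - ballCount d k := by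
    rw [ballCount_succ, Nat.cast_add, add_sub_cancel_left]
  rw [hcard]
  rfl

theorem constantTerm_nonneg (d k : ℕ) : 0 ≤ constantTerm (d + 1) k := by
  rw [constantTerm_eq]
  positivity

theorem constantTerm_le (d k : ℕ) :
    constantTerm (d + 2) k ≤ 2 ^ (d + 1) * (d + 2).factorial * (1 / ((k + 2 : ℕ) : ℝ) ^ 2) := by
  have hcard : (shell (d + 1) (k + 1)).card ≤ 2 ^ (d + 1) * (k + 2) ^ d :=
    calc (shell (d + 1) (k + 1)).card = ballCount d (k + 1) + ballCount d k :=
          card_shell_succ_succ d k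
      _ ≤ ballCount d (k + 1) + ballCount d (k + 1) := by gcongr; exact ballCount_mono d k.le_succ
      _ ≤ (2 * (k + 2)) ^ d + (2 * (k + 2)) ^ d := by
          have : ballCount d (k + 1) ≤ (2 * (k + 2)) ^ d :=
            (ballCount_le_pow d (k + 1)).trans (by gcongr; omega)
          gcongr
      _ = 2 ^ (d + 1) * (k + 2) ^ d := by rw [mul_pow]; ring
  have hball : ((k : ℝ) + 2) ^ (d + 2) ≤ (d + 2).factorial * ballCount (d + 2) (k + 1) := by
    have := pow_le_factorial_mul_ballCount (d + 2) (k + 1)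
    rwa [Nat.cast_succ, add_assoc, one_add_one_eq_two] at this
  have hpos : (0 : ℝ) < ballCount (d + 2) (k + 1) := Nat.cast_pos.2 (ballCount_pos _ _)
  rw [constantTerm_eq, mul_one_div, div_le_div_iff₀ hpos (by positivity)]
  push_cast
  calc ((shell (d + 1) (k + 1)).card : ℝ) * ((k : ℝ) + 2) ^ 2
      ≤ 2 ^ (d + 1) * ((k : ℝ) + 2) ^ d * ((k : ℝ) + 2) ^ 2 := by gcongr; exact_mod_cast hcard
    _ = 2 ^ (d + 1) * ((k : ℝ) + 2) ^ (d + 2) := by ring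
    _ ≤ 2 ^ (d + 1) * ((d + 2).factorial * ballCount (d + 2) (k + 1)) := by gcongr
    _ = 2 ^ (d + 1) * (d + 2).factorial * ballCount (d + 2) (k + 1) := by ring

theorem summable_constantTerm (d : ℕ) : Summable (constantTerm (d + 1)) := by
  cases d with
  | zero =>
    have hzero : constantTerm (0 + 1) = 0 := by
      funext k
      have := ballCount_succ 0 k
      rw [ballCount_dim_zero, ballCount_dim_zero] at this
      rw [constantTerm_eq, show (shell 0 (k + 1)).card = 0 by omega]
      simp
    exact hzero ▸ summable_zero
  | succ d =>
    have hbound : Summable fun k : ℕ =>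
        2 ^ (d + 1) * ((d + 2).factorial : ℝ) * (1 / ((k + 2 : ℕ) : ℝ) ^ 2) :=
      ((summable_nat_add_iff 2).2 (Real.summable_one_div_nat_pow.2 one_lt_two)).mul_left _
    exact hbound.of_nonneg_of_le (constantTerm_nonneg (d + 1)) (constantTerm_le d)

theorem sharpConstant_pos (d : ℕ) : 0 < sharpConstant (d + 1) := by
  have : 0 ≤ ∑' k, constantTerm (d + 1) k := tsum_nonneg (constantTerm_nonneg d)
  unfold sharpConstant
  positivity

/-! ### The maximal function of a unit mass -/

/-- The maximal function of the unit mass at the origin, `x ↦ 1 / N(‖x‖₁)`: the best ball centred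
at `x` is the smallest one reaching the origin. -/
def deltaProfile {d : ℕ} (x : Fin d → ℤ) : ℝ := 1 / (ballCount d (natNorm x) : ℝ)

/-- The increment of `deltaProfile` across the lattice edge from `x` to `x + eᵢ`, in absolute
value. -/
def edgeGap {d : ℕ} (i : Fin d) (x : Fin d → ℤ) : ℝ :=
  |deltaProfile (x + Pi.single i 1) - deltaProfile x|

section deltaProfile

variable {d : ℕ} {i : Fin d} {x : Fin d → ℤ}

theorem edgeGap_of_nonneg (hx : 0 ≤ x i) : edgeGap i x = gap d (natNorm x) := by
  rw [edgeGap, deltaProfile, natNorm_add_single_of_nonneg hx, abs_sub_comm]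
  exact abs_of_nonneg (gap_nonneg d _)

theorem edgeGap_of_neg (hx : x i < 0) : edgeGap i x = gap d (natNorm (x + Pi.single i 1)) := by
  rw [edgeGap, deltaProfile, deltaProfile, natNorm_eq_add_single_add_one hx]
  exact abs_of_nonneg (gap_nonneg d _)

theorem tsum_natNorm (d : ℕ) (h : ℕ → ℝ≥0∞) :
    ∑' x : Fin d → ℤ, h (natNorm x) = ∑' k : ℕ, (shell d k).card * h k := by
  rw [← ENNReal.tsum_fiberwise _ natNorm]
  refine tsum_congr fun k => ?_
  have hfiber : natNorm ⁻¹' {k} = (shell d k : Set (Fin d → ℤ)) := by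
    ext x
    exact mem_shell.symm
  rw [hfiber]
  calc ∑' x : (shell d k : Set (Fin d → ℤ)), h (natNorm x.1)
      = ∑ x ∈ shell d k, h (natNorm x) := Finset.tsum_subtype' (shell d k) fun x => h (natNorm x)
    _ = ∑ _x ∈ shell d k, h k := Finset.sum_congr rfl fun x hx => by rw [mem_shell.1 hx]
    _ = (shell d k).card * h k := by rw [Finset.sum_const, nsmul_eq_mul]

theorem tsum_eq_tsum_insertNth (i : Fin (d + 1)) (h : (Fin (d + 1) → ℤ) → ℝ≥0∞) :
    ∑' x, h x = ∑' (y : Fin d → ℤ) (j : ℤ), h (Fin.insertNth i j y) := by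
  rw [← (Fin.insertNthEquiv (fun _ => ℤ) i).tsum_eq, ENNReal.tsum_prod', ENNReal.tsum_comm]
  rfl

theorem tsum_edgeGap_line (i : Fin (d + 1)) (y : Fin d → ℤ) :
    ∑' j : ℤ, ENNReal.ofReal (edgeGap i (Fin.insertNth i j y)) =
      2 * ENNReal.ofReal (1 / (ballCount (d + 1) (natNorm y) : ℝ)) := by
  have hshift : ∀ j : ℤ, (Fin.insertNth i j y : Fin (d + 1) → ℤ) + Pi.single i 1 =
      Fin.insertNth i (j + 1) y := fun j => by
    rw [← Fin.insertNth_zero_right, ← Fin.insertNth_add, add_zero]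
  have hright : ∀ j : ℕ, edgeGap i (Fin.insertNth i (j : ℤ) y) = gap (d + 1) (natNorm y + j) :=
    fun j => by
      rw [edgeGap_of_nonneg (by simp), natNorm_insertNth, Int.natAbs_natCast, add_comm j]
  have hleft : ∀ j : ℕ, edgeGap i (Fin.insertNth i (-((j : ℤ) + 1)) y) =
      gap (d + 1) (natNorm y + j) := fun j => by
    rw [edgeGap_of_neg (by simp; omega), hshift, natNorm_insertNth, neg_add_rev,
      neg_add_cancel_comm, Int.natAbs_neg, Int.natAbs_natCast, add_comm j]
  rw [tsum_of_nat_of_neg_add_one ENNReal.summable ENNReal.summable, two_mul]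
  simp only [hright, hleft, tsum_ofReal_gap]

-- Each line parallel to `eᵢ` is summed by telescoping, so only the distances of the lines from the
-- origin remain, and these are grouped into the shells of `ℤ^d`.
theorem tsum_ofReal_edgeGap (i : Fin (d + 1)) :
    ∑' x, ENNReal.ofReal (edgeGap i x) =
      ENNReal.ofReal (2 * (1 + ∑' k, constantTerm (d + 1) k)) := by
  have hterm : ∀ k, ((shell d (k + 1)).card : ℝ≥0∞) *
      ENNReal.ofReal (1 / (ballCount (d + 1) (k + 1) : ℝ)) =
        ENNReal.ofReal (constantTerm (d + 1) k) := fun k => by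
    rw [← ENNReal.ofReal_natCast, ← ENNReal.ofReal_mul (Nat.cast_nonneg _), mul_one_div,
      constantTerm_eq]
  calc ∑' x, ENNReal.ofReal (edgeGap i x)
      = 2 * ∑' y : Fin d → ℤ, ENNReal.ofReal (1 / (ballCount (d + 1) (natNorm y) : ℝ)) := by
        rw [tsum_eq_tsum_insertNth i]
        simp only [tsum_edgeGap_line, ENNReal.tsum_mul_left]
    _ = 2 * (1 + ∑' k, ENNReal.ofReal (constantTerm (d + 1) k)) := by
        rw [tsum_natNorm d fun k => ENNReal.ofReal (1 / (ballCount (d + 1) k : ℝ)),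
          tsum_eq_zero_add' ENNReal.summable, tsum_congr hterm]
        simp [shell_zero, ballCount_radius_zero]
    _ = ENNReal.ofReal (2 * (1 + ∑' k, constantTerm (d + 1) k)) := by
        have hnonneg := constantTerm_nonneg d
        rw [← ENNReal.ofReal_tsum_of_nonneg hnonneg (summable_constantTerm d),
          ENNReal.ofReal_mul two_pos.le, ENNReal.ofReal_add one_pos.le (tsum_nonneg hnonneg),
          ENNReal.ofReal_ofNat, ENNReal.ofReal_one]

theorem variation_deltaProfile (d : ℕ) :
    variation (deltaProfile (d := d + 1)) = ENNReal.ofReal (sharpConstant (d + 1)) := by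
  change ∑ i, ∑' x, ENNReal.ofReal (edgeGap i x) = _
  simp only [tsum_ofReal_edgeGap, Finset.sum_const, Finset.card_univ, Fintype.card_fin,
    nsmul_eq_mul]
  rw [← ENNReal.ofReal_natCast, ← ENNReal.ofReal_mul (Nat.cast_nonneg _), sharpConstant]
  congr 1
  ring

end deltaProfile

/-! ### Convolution with `|f|` -/

/-- The convolution of `|f|` with the weight `w`; averages and all error terms are of this form. -/
def absConv {G : Type*} [AddGroup G] (f w : G → ℝ) (n : G) : ℝ := ∑' p, |f p| * w (n - p)

section absConv

variable {G : Type*} [AddGroup G] {f v w : G → ℝ}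

theorem summable_absConv (hf : Summable fun p => |f p|) (hw : BddAbove (Set.range fun x => |w x|))
    (n : G) : Summable fun p => |f p| * w (n - p) := by
  obtain ⟨c, hc⟩ := hw
  refine (hf.mul_right c).of_norm_bounded fun p => ?_
  rw [Real.norm_eq_abs, abs_mul, abs_abs]
  exact mul_le_mul_of_nonneg_left (hc ⟨n - p, rfl⟩) (abs_nonneg _)

theorem absConv_le_absConv (hf : Summable fun p => |f p|)
    (hv : BddAbove (Set.range fun x => |v x|)) (hw : BddAbove (Set.range fun x => |w x|)) {a b : G}
    (h : ∀ p, v (a - p) ≤ w (b - p)) : absConv f v a ≤ absConv f w b :=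
  (summable_absConv hf hv a).tsum_le_tsum
    (fun p => mul_le_mul_of_nonneg_left (h p) (abs_nonneg _)) (summable_absConv hf hw b)

theorem absConv_lt_absConv (hf : Summable fun p => |f p|)
    (hv : BddAbove (Set.range fun x => |v x|)) (hw : BddAbove (Set.range fun x => |w x|)) {a b : G}
    (h : ∀ p, v (a - p) ≤ w (b - p)) {q : G} (hq : f q ≠ 0) (hlt : v (a - q) < w (b - q)) :
    absConv f v a < absConv f w b :=
  (summable_absConv hf hv a).tsum_lt_tsum
    (fun p => mul_le_mul_of_nonneg_left (h p) (abs_nonneg _))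
    (mul_lt_mul_of_pos_left hlt (abs_pos.2 hq)) (summable_absConv hf hw b)

theorem absConv_le_add (hf : Summable fun p => |f p|) {u : G → ℝ}
    (hu : BddAbove (Set.range fun x => |u x|)) (hv : BddAbove (Set.range fun x => |v x|))
    (hw : BddAbove (Set.range fun x => |w x|)) {a b c : G}
    (h : ∀ p, u (a - p) ≤ v (b - p) + w (c - p)) :
    absConv f u a ≤ absConv f v b + absConv f w c := by
  have hsv := summable_absConv hf hv b
  have hsw := summable_absConv hf hw c
  rw [absConv, absConv, absConv, ← hsv.tsum_add hsw]
  refine (summable_absConv hf hu a).tsum_le_tsum (fun p => ?_) (hsv.add hsw)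
  rw [← mul_add]
  exact mul_le_mul_of_nonneg_left (h p) (abs_nonneg _)

theorem absConv_of_support_subset_singleton {p : G} (hp : ∀ q, q ≠ p → f q = 0) (w : G → ℝ)
    (n : G) : absConv f w n = |f p| * w (n - p) :=
  tsum_eq_single p fun q hq => by rw [hp q hq, abs_zero, zero_mul]

theorem tsum_ofReal_absConv (hf : Summable fun p => |f p|)
    (hw : BddAbove (Set.range fun x => |w x|)) (hw₀ : ∀ x, 0 ≤ w x) :
    ∑' n, ENNReal.ofReal (absConv f w n) =
      ENNReal.ofReal (∑' p, |f p|) * ∑' x, ENNReal.ofReal (w x) := by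
  calc ∑' n, ENNReal.ofReal (absConv f w n)
      = ∑' (n) (p), ENNReal.ofReal |f p| * ENNReal.ofReal (w (n - p)) := tsum_congr fun n => by
        rw [absConv, ENNReal.ofReal_tsum_of_nonneg
          (fun p => mul_nonneg (abs_nonneg _) (hw₀ _)) (summable_absConv hf hw n)]
        exact tsum_congr fun p => ENNReal.ofReal_mul (abs_nonneg _)
    _ = ∑' (p) (n), ENNReal.ofReal |f p| * ENNReal.ofReal (w (n - p)) := ENNReal.tsum_comm
    _ = ∑' p, ENNReal.ofReal |f p| * ∑' x, ENNReal.ofReal (w x) := tsum_congr fun p => by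
        rw [ENNReal.tsum_mul_left]
        exact congrArg _ ((Equiv.subRight p).tsum_eq fun x => ENNReal.ofReal (w x))
    _ = ENNReal.ofReal (∑' p, |f p|) * ∑' x, ENNReal.ofReal (w x) := by
        rw [ENNReal.tsum_mul_right, ENNReal.ofReal_tsum_of_nonneg (fun p => abs_nonneg _) hf]

end absConv

/-! ### Averages and the maximal function -/

/-- The kernel of the average over the ball of radius `k`. -/
def ballWeight {d : ℕ} (k : ℕ) (x : Fin d → ℤ) : ℝ :=
  if natNorm x ≤ k then 1 / (ballCount d k : ℝ) else 0

section weights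

variable {d : ℕ}

theorem bddAbove_range_abs_of_mem_Icc {α : Type*} {w : α → ℝ} (h : ∀ x, w x ∈ Set.Icc 0 1) :
    BddAbove (Set.range fun x => |w x|) :=
  ⟨1, Set.forall_mem_range.2 fun x => (abs_of_nonneg (h x).1).trans_le (h x).2⟩

theorem ballWeight_mem_Icc (k : ℕ) (x : Fin d → ℤ) : ballWeight k x ∈ Set.Icc (0 : ℝ) 1 := by
  unfold ballWeight
  split_ifs
  exacts [⟨by positivity, one_div_ballCount_le_one d k⟩, ⟨le_rfl, zero_le_one⟩]

theorem bddAbove_ballWeight (k : ℕ) :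
    BddAbove (Set.range fun x : Fin d → ℤ => |ballWeight k x|) :=
  bddAbove_range_abs_of_mem_Icc (ballWeight_mem_Icc k)

theorem bddAbove_gap : BddAbove (Set.range fun x : Fin d → ℤ => |gap d (natNorm x)|) :=
  bddAbove_range_abs_of_mem_Icc fun _ => ⟨gap_nonneg _ _, gap_le_one _ _⟩

theorem bddAbove_edgeGap (i : Fin d) : BddAbove (Set.range fun x => |edgeGap i x|) :=
  bddAbove_range_abs_of_mem_Icc fun x => by
    rcases le_or_gt 0 (x i) with hx | hx
    · exact edgeGap_of_nonneg hx ▸ ⟨gap_nonneg _ _, gap_le_one _ _⟩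
    · exact edgeGap_of_neg hx ▸ ⟨gap_nonneg _ _, gap_le_one _ _⟩

theorem ballWeight_le_deltaProfile (k : ℕ) (x : Fin d → ℤ) : ballWeight k x ≤ deltaProfile x := by
  unfold ballWeight deltaProfile
  split_ifs with hx
  exacts [one_div_ballCount_anti d hx, by positivity]

theorem ballWeight_natNorm (x : Fin d → ℤ) : ballWeight (natNorm x) x = deltaProfile x :=
  if_pos le_rfl

theorem ballWeight_le_add_gap {x y : Fin (d + 1) → ℤ} (hxy : natNorm y ≤ natNorm x + 1) (k : ℕ) :
    ballWeight k x ≤ ballWeight (k + 1) y + gap (d + 1) (natNorm x) := by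
  by_cases hx : natNorm x ≤ k
  · have hgap : gap (d + 1) k ≤ gap (d + 1) (natNorm x) := (gap_strictAnti d).antitone hx
    rw [ballWeight, if_pos hx, ballWeight, if_pos (by omega)]
    exact sub_le_iff_le_add'.1 hgap
  · rw [ballWeight, if_neg hx]
    exact add_nonneg (ballWeight_mem_Icc _ _).1 (gap_nonneg _ _)

theorem gap_natNorm_le_edgeGap (i : Fin (d + 1)) (x : Fin (d + 1) → ℤ) :
    gap (d + 1) (natNorm x) ≤ edgeGap i x := by
  rcases le_or_gt 0 (x i) with hx | hx
  · exact (edgeGap_of_nonneg hx).ge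
  · rw [edgeGap_of_neg hx]
    exact (gap_strictAnti d).antitone (natNorm_eq_add_single_add_one hx ▸ Nat.le_succ _)

theorem gap_natNorm_lt_edgeGap {i : Fin (d + 1)} {x : Fin (d + 1) → ℤ} (hx : x i < 0) :
    gap (d + 1) (natNorm x) < edgeGap i x := by
  rw [edgeGap_of_neg hx]
  exact gap_strictAnti d (natNorm_eq_add_single_add_one hx ▸ Nat.lt_succ_self _)

theorem gap_natNorm_add_single_lt_edgeGap {i : Fin (d + 1)} {x : Fin (d + 1) → ℤ} (hx : 0 ≤ x i) :
    gap (d + 1) (natNorm (x + Pi.single i 1)) < edgeGap i x := by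
  rw [edgeGap_of_nonneg hx, natNorm_add_single_of_nonneg hx]
  exact gap_strictAnti d (Nat.lt_succ_self _)

theorem gap_natNorm_add_single_le_edgeGap (i : Fin (d + 1)) (x : Fin (d + 1) → ℤ) :
    gap (d + 1) (natNorm (x + Pi.single i 1)) ≤ edgeGap i x := by
  rcases le_or_gt 0 (x i) with hx | hx
  · exact (gap_natNorm_add_single_lt_edgeGap hx).le
  · exact (edgeGap_of_neg hx).ge

end weights

section maximalFunction

variable {d : ℕ} {f : (Fin d → ℤ) → ℝ}

theorem average_natCast (f : (Fin d → ℤ) → ℝ) (k : ℕ) (n : Fin d → ℤ) :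
    average f k n = absConv f (ballWeight k) n := by
  have hweight : ∀ m, ballWeight k (n - (n + m)) =
      if m ∈ rhombus d (k : ℝ) then 1 / (latticeCount d k : ℝ) else 0 := fun m => by
    simp only [sub_add_cancel_left, ballWeight, natNorm_neg, mem_rhombus_natCast, ballCount]
  rw [absConv, ← (Equiv.addLeft n).tsum_eq, tsum_eq_sum (s := rhombus d (k : ℝ)), average,
    Finset.mul_sum]
  · refine Finset.sum_congr rfl fun m hm => ?_
    rw [Equiv.coe_addLeft, hweight, if_pos hm, mul_comm]
  · intro m hm
    rw [Equiv.coe_addLeft, hweight, if_neg hm, mul_zero]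

theorem maximalFunction_eq_iSup (f : (Fin d → ℤ) → ℝ) (n : Fin d → ℤ) :
    maximalFunction f n = ⨆ k : ℕ, absConv f (ballWeight k) n := by
  have hfloor : Function.Surjective (Nat.floor : ℝ≥0 → ℕ) := fun k => ⟨k, Nat.floor_natCast k⟩
  rw [maximalFunction, ← hfloor.iSup_comp]
  refine iSup_congr fun r => ?_
  rw [← average_natCast, average, average, latticeCount, latticeCount, rhombus_floor]

theorem absConv_ballWeight_le_maximalFunction (hf : Summable fun p => |f p|) (k : ℕ)
    (n : Fin d → ℤ) : absConv f (ballWeight k) n ≤ maximalFunction f n := by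
  rw [maximalFunction_eq_iSup]
  refine le_ciSup (f := fun k => absConv f (ballWeight k) n) ⟨∑' p, |f p|, ?_⟩ k
  exact Set.forall_mem_range.2 fun k =>
    (summable_absConv hf (bddAbove_ballWeight k) n).tsum_le_tsum
      (fun p => mul_le_of_le_one_right (abs_nonneg _) (ballWeight_mem_Icc k _).2) hf

theorem maximalFunction_of_support_subset_singleton {p : Fin d → ℤ} (hp : ∀ q, q ≠ p → f q = 0)
    (n : Fin d → ℤ) : maximalFunction f n = |f p| * deltaProfile (n - p) := by
  simp only [maximalFunction_eq_iSup, absConv_of_support_subset_singleton hp]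
  have hle : ∀ k, |f p| * ballWeight k (n - p) ≤ |f p| * deltaProfile (n - p) := fun k =>
    mul_le_mul_of_nonneg_left (ballWeight_le_deltaProfile k _) (abs_nonneg _)
  refine le_antisymm (ciSup_le hle) ?_
  rw [← ballWeight_natNorm]
  exact le_ciSup (f := fun k => |f p| * ballWeight k (n - p)) ⟨_, Set.forall_mem_range.2 hle⟩ _

end maximalFunction

section increments

variable {d : ℕ} {f : (Fin (d + 1) → ℤ) → ℝ}

-- A ball of radius `k` about `a` is compared with the ball of radius `k + 1` about `b`, which
-- contains it when `a` and `b` are adjacent.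
theorem maximalFunction_le_add (hf : Summable fun p => |f p|) {a b : Fin (d + 1) → ℤ}
    (hab : ∀ p, natNorm (b - p) ≤ natNorm (a - p) + 1) :
    maximalFunction f a ≤
      maximalFunction f b + absConv f (fun x => gap (d + 1) (natNorm x)) a := by
  rw [maximalFunction_eq_iSup f a]
  refine ciSup_le fun k => ?_
  calc absConv f (ballWeight k) a
      ≤ absConv f (ballWeight (k + 1)) b + absConv f (fun x => gap (d + 1) (natNorm x)) a :=
        absConv_le_add hf (bddAbove_ballWeight k) (bddAbove_ballWeight (k + 1)) bddAbove_gap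
          fun p => ballWeight_le_add_gap (hab p) k
    _ ≤ maximalFunction f b + absConv f (fun x => gap (d + 1) (natNorm x)) a := by
        gcongr
        exact absConv_ballWeight_le_maximalFunction hf (k + 1) b

theorem abs_maximalFunction_sub_le_max (hf : Summable fun p => |f p|) (i : Fin (d + 1))
    (n : Fin (d + 1) → ℤ) :
    |maximalFunction f (n + Pi.single i 1) - maximalFunction f n| ≤
      max (absConv f (fun x => gap (d + 1) (natNorm x)) (n + Pi.single i 1))
        (absConv f (fun x => gap (d + 1) (natNorm x)) n) := by
  have hstep : ∀ p, natNorm (n + Pi.single i 1 - p) + (n i - p i).natAbs =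
      natNorm (n - p) + (n i - p i + 1).natAbs := fun p => by
    rw [add_sub_right_comm]
    exact natNorm_add_single i (n - p)
  have hdown : ∀ p, natNorm (n - p) ≤ natNorm (n + Pi.single i 1 - p) + 1 := fun p => by
    have := hstep p
    omega
  have hup : ∀ p, natNorm (n + Pi.single i 1 - p) ≤ natNorm (n - p) + 1 := fun p => by
    have := hstep p
    omega
  exact abs_sub_le_iff.2
    ⟨le_max_of_le_left (sub_le_iff_le_add'.2 (maximalFunction_le_add hf hdown)),
      le_max_of_le_right (sub_le_iff_le_add'.2 (maximalFunction_le_add hf hup))⟩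

theorem abs_maximalFunction_sub_le (hf : Summable fun p => |f p|) (i : Fin (d + 1))
    (n : Fin (d + 1) → ℤ) :
    |maximalFunction f (n + Pi.single i 1) - maximalFunction f n| ≤ absConv f (edgeGap i) n :=
  (abs_maximalFunction_sub_le_max hf i n).trans <| max_le
    (absConv_le_absConv hf bddAbove_gap (bddAbove_edgeGap i) fun p => by
      rw [add_sub_right_comm]
      exact gap_natNorm_add_single_le_edgeGap i (n - p))
    (absConv_le_absConv hf bddAbove_gap (bddAbove_edgeGap i) fun p =>
      gap_natNorm_le_edgeGap i (n - p))

-- The end of the edge farther from `p` is `p + eᵢ`, the one farther from `q` is `p`. Each one-sided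
-- estimate measures both distances from the same end, hence loses at one of the two points.
theorem abs_maximalFunction_sub_lt (hf : Summable fun p => |f p|) {i : Fin (d + 1)}
    {p q : Fin (d + 1) → ℤ} (hp : f p ≠ 0) (hq : f q ≠ 0) (hpq : p i < q i) :
    |maximalFunction f (p + Pi.single i 1) - maximalFunction f p| < absConv f (edgeGap i) p := by
  refine (abs_maximalFunction_sub_le_max hf i p).trans_lt (max_lt ?_ ?_)
  · refine absConv_lt_absConv hf bddAbove_gap (bddAbove_edgeGap i) (fun x => ?_) hp ?_ <;>
      rw [add_sub_right_comm]
    · exact gap_natNorm_add_single_le_edgeGap i (p - x)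
    · exact gap_natNorm_add_single_lt_edgeGap (by simp)
  · exact absConv_lt_absConv hf bddAbove_gap (bddAbove_edgeGap i)
      (fun x => gap_natNorm_le_edgeGap i (p - x)) hq (gap_natNorm_lt_edgeGap (sub_neg.2 hpq))

end increments

/-! ### The variation of the maximal function -/

section variation

variable {d : ℕ} {f : (Fin (d + 1) → ℤ) → ℝ}

theorem variation_eq_tsum_prod {d : ℕ} (g : (Fin d → ℤ) → ℝ) :
    variation g = ∑' e : Fin d × (Fin d → ℤ),
      ENNReal.ofReal |g (e.2 + Pi.single e.1 1) - g e.2| := by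
  rw [ENNReal.tsum_prod', tsum_fintype, variation]

theorem tsum_ofReal_absConv_edgeGap (hf : Summable fun p => |f p|) :
    ∑' e : Fin (d + 1) × (Fin (d + 1) → ℤ), ENNReal.ofReal (absConv f (edgeGap e.1) e.2) =
      ENNReal.ofReal (sharpConstant (d + 1) * ∑' p, |f p|) := by
  rw [ENNReal.tsum_prod', tsum_fintype]
  simp only [tsum_ofReal_absConv hf (bddAbove_edgeGap _) fun _ => abs_nonneg _]
  rw [← Finset.mul_sum, ENNReal.ofReal_mul (sharpConstant_pos d).le, mul_comm,
    ← variation_deltaProfile]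
  rfl

theorem variation_maximalFunction_le (hf : Summable fun p => |f p|) :
    variation (maximalFunction f) ≤ ENNReal.ofReal (sharpConstant (d + 1) * ∑' p, |f p|) := by
  rw [← tsum_ofReal_absConv_edgeGap hf, variation_eq_tsum_prod]
  exact ENNReal.tsum_le_tsum fun e =>
    ENNReal.ofReal_le_ofReal (abs_maximalFunction_sub_le hf e.1 e.2)

theorem exists_edge_of_not_isDelta {d : ℕ} {f : (Fin d → ℤ) → ℝ} (h : ¬ IsDelta f) :
    ∃ p q, f p ≠ 0 ∧ f q ≠ 0 ∧ ∃ i, p i < q i := by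
  obtain ⟨p, hp⟩ : ∃ p, f p ≠ 0 := by
    by_contra! hzero
    exact h ⟨0, f 0, rfl, fun n _ => hzero n⟩
  obtain ⟨q, hqp, hq⟩ : ∃ q, q ≠ p ∧ f q ≠ 0 := by
    by_contra! hzero
    exact h ⟨p, f p, rfl, hzero⟩
  obtain ⟨i, hi⟩ := Function.ne_iff.1 hqp
  rcases lt_or_gt_of_ne hi with hlt | hlt
  exacts [⟨q, p, hq, hp, i, hlt⟩, ⟨p, q, hp, hq, i, hlt⟩]

theorem variation_maximalFunction_lt (hf : Summable fun p => |f p|) (hdelta : ¬ IsDelta f) :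
    variation (maximalFunction f) < ENNReal.ofReal (sharpConstant (d + 1) * ∑' p, |f p|) := by
  obtain ⟨p, q, hp, hq, i, hpq⟩ := exists_edge_of_not_isDelta hdelta
  have hfinite : variation (maximalFunction f) ≠ ∞ :=
    ((variation_maximalFunction_le hf).trans_lt ENNReal.ofReal_lt_top).ne
  have hlt : ENNReal.ofReal |maximalFunction f (p + Pi.single i 1) - maximalFunction f p| <
      ENNReal.ofReal (absConv f (edgeGap i) p) :=
    (ENNReal.ofReal_lt_ofReal_iff_of_nonneg (abs_nonneg _)).2
      (abs_maximalFunction_sub_lt hf hp hq hpq)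
  rw [variation_eq_tsum_prod] at hfinite ⊢
  rw [← tsum_ofReal_absConv_edgeGap hf]
  exact ENNReal.tsum_lt_tsum (i := (i, p)) hfinite
    (fun e => ENNReal.ofReal_le_ofReal (abs_maximalFunction_sub_le hf e.1 e.2)) hlt

theorem variation_maximalFunction_of_isDelta (hf : Summable fun p => |f p|) (hdelta : IsDelta f) :
    variation (maximalFunction f) = ENNReal.ofReal (sharpConstant (d + 1) * ∑' p, |f p|) := by
  obtain ⟨p, -, -, hp⟩ := hdelta
  rw [← tsum_ofReal_absConv_edgeGap hf, variation_eq_tsum_prod]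
  refine tsum_congr fun e => congrArg ENNReal.ofReal ?_
  rw [maximalFunction_of_support_subset_singleton hp,
    maximalFunction_of_support_subset_singleton hp, absConv_of_support_subset_singleton hp,
    ← mul_sub, abs_mul, abs_abs, add_sub_right_comm, edgeGap]

theorem variation_maximalFunction_eq_iff (hf : Summable fun p => |f p|) :
    variation (maximalFunction f) = ENNReal.ofReal (sharpConstant (d + 1) * ∑' p, |f p|) ↔
      IsDelta f :=
  ⟨fun h => by_contra fun hdelta => (variation_maximalFunction_lt hf hdelta).ne h,
    variation_maximalFunction_of_isDelta hf⟩

end variation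

section lp

variable {α : Type*}

theorem summable_abs_coe_lp (f : lp (fun _ : α => ℝ) 1) : Summable fun p => |f p| :=
  (lp.memℓp f).summable_of_one.abs

theorem lp_one_norm_eq_tsum_abs (f : lp (fun _ : α => ℝ) 1) : ‖f‖ = ∑' p, |f p| := by
  simpa using lp.norm_eq_tsum_rpow (p := 1) (by simp) f

theorem isDelta_lp_single {d : ℕ} (p : Fin d → ℤ) (c : ℝ) :
    IsDelta (lp.single (E := fun _ : Fin d → ℤ => ℝ) 1 p c) :=
  ⟨p, c, by simp, fun n hn => by simp [hn]⟩

theorem sharpConstant_le_of_forall {d : ℕ} {C : ℝ}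
    (hC : ∀ f : lp (fun _ : Fin (d + 1) → ℤ => ℝ) 1,
      variation (maximalFunction f) ≤ ENNReal.ofReal (C * ‖f‖)) :
    sharpConstant (d + 1) ≤ C := by
  set δ : lp (fun _ : Fin (d + 1) → ℤ => ℝ) 1 := lp.single 1 0 1
  have hnorm : ‖δ‖ = 1 := by simp [δ, lp.norm_single]
  have hδ := hC δ
  rw [variation_maximalFunction_of_isDelta (summable_abs_coe_lp δ) (isDelta_lp_single 0 1),
    ← lp_one_norm_eq_tsum_abs, hnorm, mul_one, mul_one] at hδ
  exact (ENNReal.ofReal_le_ofReal_iff'.1 hδ).resolve_right (sharpConstant_pos d).not_ge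

end lp

end DiscreteMaximal

end

theorem theorem2_general (d : ℕ) (hd : 1 ≤ d) :
    Summable (constantTerm d) ∧
    (∀ f : lp (fun _ : Fin d → ℤ => ℝ) 1,
      variation (maximalFunction f) ≤ ENNReal.ofReal (sharpConstant d * ‖f‖)) ∧
    (∀ C : ℝ,
      (∀ f : lp (fun _ : Fin d → ℤ => ℝ) 1,
        variation (maximalFunction f) ≤ ENNReal.ofReal (C * ‖f‖)) →
      sharpConstant d ≤ C) ∧
    (∀ f : lp (fun _ : Fin d → ℤ => ℝ) 1,
      variation (maximalFunction f) = ENNReal.ofReal (sharpConstant d * ‖f‖) ↔ IsDelta f) := by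
  obtain ⟨d, rfl⟩ := Nat.exists_eq_add_of_le' hd
  refine ⟨summable_constantTerm d, fun f => ?_, fun _ => sharpConstant_le_of_forall, fun f => ?_⟩
  · rw [lp_one_norm_eq_tsum_abs]
    exact variation_maximalFunction_le (summable_abs_coe_lp f)
  · rw [lp_one_norm_eq_tsum_abs]
    exact variation_maximalFunction_eq_iff (summable_abs_coe_lp f)

theorem theorem2 (d : ℕ) (hd : 2 ≤ d) :
    Summable (constantTerm d) ∧
    (∀ f : lp (fun _ : Fin d → ℤ => ℝ) 1,
      variation (maximalFunction f) ≤ ENNReal.ofReal (sharpConstant d * ‖f‖)) ∧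
    (∀ C : ℝ,
      (∀ f : lp (fun _ : Fin d → ℤ => ℝ) 1,
        variation (maximalFunction f) ≤ ENNReal.ofReal (C * ‖f‖)) →
      sharpConstant d ≤ C) ∧
    (∀ f : lp (fun _ : Fin d → ℤ => ℝ) 1,
      variation (maximalFunction f) = ENNReal.ofReal (sharpConstant d * ‖f‖) ↔ IsDelta f) :=
  theorem2_general d (one_le_two.trans hd)
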